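/- Let $X$ be a smooth, connected, finite-dimensional Riemannian manifold without boundary, with metric $\langle\cdot,\cdot\rangle_g$ and norm $|\cdot|_g$, which is complete for its Riemannian distance $d$. Let $F:X\to\mathbb R$ be smooth, let $\lambda\in\mathbb R$, and let $S_t:X\to X$, $t\ge 0$, be a smooth semigroup: $S_0(u)=u$ and $S_{t+h}(u)=S_h(S_t(u))$ for all $u\in X$ and $t,h\ge0$, and $(t,u)\mapsto S_t(u)$ is smooth on $[0,\infty)\times X$. For a smooth curve $\gamma:[0,1]\to X$, $s\mapsto\gamma^s$, put $$\tilde\gamma^s_t:=S_{st}(\gamma^s),\qquad \tilde A^s_t:=\big|\partial_s\tilde\gamma^s_t\big|_g^2,\qquad \tilde F^s_t:=F(\tilde\gamma^s_t),\qquad s\in[0,1],\ t\ge0,$$ and consider the inequality $$\frac12\,\frac{\partial}{\partial t}\tilde A^s_t+\frac{\partial}{\partial s}\tilde F^s_t\le-\lambda\,s\,\tilde A^s_t \qquad(\ast)$$ (with one-sided derivatives at $t=0$ and at $s=0,1$). 1. Suppose that for every smooth curve $\gamma:[0,1]\to X$ the inequality $(\ast)$ holds for all $s\in[0,1]$ and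 all $t\ge0$. Then: - (Evolution Variational Inequality) for all $u,v\in X$ and all $t\ge0$, $$\frac12\frac{d^+}{dt}d^2(S_t(u),v)+\frac\lambda2\,d^2(S_t(u),v)+F(S_t(u))\le F(v),\qquad \frac{d^+}{dt}\zeta(t):=\limsup_{h\downarrow0}\frac{\zeta(t+h)-\zeta(t)}{h};$$ - $S$ is the gradient flow of $F$: for every $u\in X$ the curve $u_t:=S_t(u)$ solves $\dot u_t=-\nabla F(u_t)$ for all $t\ge0$, with $u_0=u$; - $F$ is geodesically $\lambda$-convex: for every minimal constant speed geodesic $\gamma:[0,1]\to X$, i.e. every curve with $d(\gamma^r,\gamma^s)=|r-s|\,d(\gamma^0,\gamma^1)$ for all $r,s\in[0,1]$, $$F(\gamma^s)\le(1-s)F(\gamma^0)+sF(\gamma^1)-\frac\lambda2\,s(1-s)\,d^2(\gamma^0,\gamma^1)\qquad\forall\,s\in[0,1].$$ 2. It is sufficient to check $(\ast)$ at $t=0$: if for every smooth curve $\gamma:[0,1]\to X$ the inequality $(\ast)$ holds at $t=0$ for all $s\in[0,1]$, then for every smooth curve it holds for all $s\in[0,1]$ and all $t\ge0$. -/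

import Mathlib

open Set Filter Manifold Bundle
open scoped Topology ContDiff

noncomputable section

namespace ActionFlow

/-- The upper right Dini derivative `d⁺ζ/dt (t) = limsup_{h ↓ 0} (ζ (t + h) - ζ t) / h`, with values
in the extended reals, so that the upper limit always exists. -/
def upperRightDeriv (ζ : ℝ → ℝ) (t : ℝ) : EReal :=
  limsup (fun h : ℝ => (((ζ (t + h) - ζ t) / h : ℝ) : EReal)) (𝓝[>] 0)

section Metric

variable {X : Type*} [MetricSpace X]

/-- The Evolution Variational Inequality for the maps `S t`, `t ≥ 0`, and the functional `F`. -/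
def SatisfiesEVI (F : X → ℝ) (lam : ℝ) (S : ℝ → X → X) : Prop :=
  ∀ u v : X, ∀ t : ℝ, 0 ≤ t →
    ((1 / 2 : ℝ) : EReal) * upperRightDeriv (fun r => dist (S r u) v ^ 2) t
      + ((lam / 2 * dist (S t u) v ^ 2 + F (S t u) : ℝ) : EReal) ≤ ((F v : ℝ) : EReal)

/-- `γ`, restricted to `[0,1]`, is a minimal geodesic with constant speed. -/
def IsMinGeodesic (γ : ℝ → X) : Prop :=
  ∀ r ∈ Icc (0 : ℝ) 1, ∀ s ∈ Icc (0 : ℝ) 1, dist (γ r) (γ s) = |r - s| * dist (γ 0) (γ 1)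

/-- (Strong) geodesic `lam`-convexity: the convexity inequality holds along every minimal
constant speed geodesic. -/
def GeodesicallyConvex (F : X → ℝ) (lam : ℝ) : Prop :=
  ∀ γ : ℝ → X, IsMinGeodesic γ → ∀ s ∈ Icc (0 : ℝ) 1,
    F (γ s) ≤ (1 - s) * F (γ 0) + s * F (γ 1)
      - lam / 2 * s * (1 - s) * dist (γ 0) (γ 1) ^ 2

end Metric

section Manifold

variable (E : Type*) [NormedAddCommGroup E] [NormedSpace ℝ E]
  {X : Type*} [TopologicalSpace X] [ChartedSpace E X]

/-- A smooth semigroup of maps `S t : X → X`, `t ≥ 0`; the values for `t < 0` are irrelevant. -/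
structure IsSmoothSemigroup (S : ℝ → X → X) : Prop where
  zero : ∀ u, S 0 u = u
  add : ∀ t h, 0 ≤ t → 0 ≤ h → ∀ u, S (t + h) u = S h (S t u)
  smooth : ContMDiffOn (𝓘(ℝ, ℝ).prod 𝓘(ℝ, E)) 𝓘(ℝ, E) ∞
    (fun p : ℝ × X => S p.1 p.2) (Ici 0 ×ˢ univ)

/-- The deformation `γ̃ˢₜ = S_{st}(γˢ)` of a curve `γ`. -/
def deform (S : ℝ → X → X) (γ : ℝ → X) (t s : ℝ) : X := S (s * t) (γ s)

variable [IsManifold 𝓘(ℝ, E) ∞ X] [RiemannianBundle (fun x : X => TangentSpace 𝓘(ℝ, E) x)]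

/-- `Ãˢₜ = |∂ₛ γ̃ˢₜ|²`, the squared Riemannian norm of the velocity in `s ∈ [0,1]` of `γ̃ₜ`. -/
def action (S : ℝ → X → X) (γ : ℝ → X) (t s : ℝ) : ℝ :=
  ‖mfderivWithin 𝓘(ℝ, ℝ) 𝓘(ℝ, E) (deform S γ t) (Icc 0 1) s (1 : TangentSpace 𝓘(ℝ, ℝ) s)‖ ^ 2

/-- For every smooth curve `γ : [0,1] → X` the inequality
`½ ∂ₜ Ãˢₜ + ∂ₛ F(γ̃ˢₜ) ≤ -lam s Ãˢₜ` holds for all `s ∈ [0,1]` at the time `t`. -/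
def ActionInequalityAt (F : X → ℝ) (lam : ℝ) (S : ℝ → X → X) (t : ℝ) : Prop :=
  ∀ γ : ℝ → X, ContMDiffOn 𝓘(ℝ, ℝ) 𝓘(ℝ, E) ∞ γ (Icc 0 1) → ∀ s ∈ Icc (0 : ℝ) 1,
    1 / 2 * derivWithin (fun r => action E S γ r s) (Ici 0) t
      + derivWithin (fun σ => F (deform S γ t σ)) (Icc 0 1) s ≤ -lam * s * action E S γ t s

variable [FiniteDimensional ℝ E]

/-- The Riemannian gradient: the tangent vector at `x` that represents the differential of `F` at
`x` in the inner product of the tangent space. -/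
def grad (F : X → ℝ) (x : X) : TangentSpace 𝓘(ℝ, E) x :=
  haveI : FiniteDimensional ℝ (TangentSpace 𝓘(ℝ, E) x) := inferInstanceAs (FiniteDimensional ℝ E)
  haveI : CompleteSpace (TangentSpace 𝓘(ℝ, E) x) := FiniteDimensional.complete ℝ _
  (InnerProductSpace.toDual ℝ (TangentSpace 𝓘(ℝ, E) x)).symm
    (mfderiv 𝓘(ℝ, E) 𝓘(ℝ, ℝ) F x : TangentSpace 𝓘(ℝ, E) x →L[ℝ] ℝ)

/-- `t ↦ S t u` solves `u̇ₜ = -∇F(uₜ)` for `t ≥ 0`, with initial datum `u`, for every `u`. -/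
def IsGradientFlow (F : X → ℝ) (S : ℝ → X → X) : Prop :=
  ∀ u : X, S 0 u = u ∧
    IsMIntegralCurveOn (I := 𝓘(ℝ, E)) (fun t => S t u) (fun x => -grad E F x) (Ici 0)

end Manifold

end ActionFlow

end

/-!
Let `V` be the generator of the flow and let `dSₜ` be its differential. The velocity in `s` of
`S_{st}(γˢ)` is `t V + dS_{st} γ̇ˢ`, so at `t = 0` the action inequality only involves `V`, `dF`,
`γ̇ˢ` and the time derivative of `‖dSₜ γ̇ˢ‖²`. Since `s` and `w = γ̇ˢ` are arbitrary,
`s = 0` gives `⟪V, w⟫ = -dF w`, i.e. `V = -∇F`, and then `s = 1` gives the contraction estimate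
`‖dSₜ w‖² ≤ e^{-2λt} ‖w‖²`. Hence, for a curve `γ` from `v` to `u`, the velocity `β'` of
`β = S_{sh}(γˢ)` satisfies `‖β'‖² ≤ ‖dS γ̇‖² + 2h ⟪V, β'⟫ ≤ e^{-2λhs} ‖γ̇‖² - 2h (F ∘ β)'`.
Integrating over `s` along nearly minimal curves `γ` bounds `d²(S_h u, v)`, and this one-step
inequality yields both the EVI, letting `h ↓ 0`, and the geodesic convexity. Moreover
`S_{s(t+h)}(γˢ) = S_{sh}(γ̃ˢₜ)`, so the action inequality for `γ` at time `t` is the one for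
`γ̃ₜ` at time `0`.
-/

noncomputable section

namespace ActionFlow

section Metric

/-- The mean `∫₀¹ e^{-2xs} ds`, the factor by which the energy of a curve is multiplied when its
point of parameter `s` moves for the time `s h` under a semigroup contracting at the rate
`λ = x / h`. -/
def expMean (x : ℝ) : ℝ := ∫ s in (0 : ℝ)..1, Real.exp (-(2 * x * s))

lemma abs_expMean_sub_one_add_le {x : ℝ} (hx : |x| ≤ 1 / 2) :
    |expMean x - 1 + x| ≤ 4 * x ^ 2 := by
  have hint : ∫ s in (0 : ℝ)..1, (Real.exp (-(2 * x * s)) - 1 - -(2 * x * s)) =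
      expMean x - 1 + x := by
    rw [intervalIntegral.integral_sub, intervalIntegral.integral_sub, intervalIntegral.integral_neg,
      intervalIntegral.integral_const_mul, integral_id, integral_one, expMean]
    · ring
    all_goals exact (by fun_prop : Continuous _).intervalIntegrable _ _
  rw [← hint, ← Real.norm_eq_abs]
  refine (intervalIntegral.norm_integral_le_of_norm_le_const (C := 4 * x ^ 2)
    fun s hs => ?_).trans_eq (by simp)
  rw [uIoc_of_le zero_le_one] at hs
  have hxs : |-(2 * x * s)| ≤ 2 * |x| := by
    rw [abs_neg, abs_mul, abs_mul, abs_two, abs_of_pos hs.1]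
    exact mul_le_of_le_one_right (by positivity) hs.2
  calc |Real.exp (-(2 * x * s)) - 1 - -(2 * x * s)| ≤ (-(2 * x * s)) ^ 2 :=
        Real.abs_exp_sub_one_sub_id_le (by linarith)
    _ ≤ (2 * |x|) ^ 2 := sq_le_sq' (by linarith [abs_le.1 hxs]) (abs_le.1 hxs).2
    _ = 4 * x ^ 2 := by rw [mul_pow, sq_abs]; norm_num

lemma tendsto_expMean_sub_one_div (lam : ℝ) :
    Tendsto (fun h => (expMean (lam * h) - 1) / h) (𝓝[>] 0) (𝓝 (-lam)) := by
  have hderiv : HasDerivAt expMean (-1) 0 := by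
    have h0 : expMean 0 = 1 := by simp [expMean]
    rw [hasDerivAt_iff_isLittleO_nhds_zero]
    refine (Asymptotics.IsBigO.of_bound 4 ?_).trans_isLittleO
      (Asymptotics.isLittleO_pow_id one_lt_two)
    filter_upwards [Metric.closedBall_mem_nhds (0 : ℝ) one_half_pos] with x hx
    rw [mem_closedBall_zero_iff, Real.norm_eq_abs] at hx
    simpa [h0] using abs_expMean_sub_one_add_le hx
  have hcomp : HasDerivAt (fun h => expMean (lam * h)) (-1 * (lam * 1)) 0 :=
    HasDerivAt.comp (0 : ℝ) (h₂ := expMean) (h := fun h => lam * h) (by simpa using hderiv)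
      ((hasDerivAt_id (0 : ℝ)).const_mul lam)
  have hslope := hcomp.tendsto_slope_zero_right
  simpa [expMean, div_eq_inv_mul] using hslope

variable {X : Type*} [MetricSpace X] {F : X → ℝ} {lam : ℝ} {S : ℝ → X → X}

/-- The Evolution Variational Inequality integrated over a time step `h`. -/
def SatisfiesOneStepEVI (F : X → ℝ) (lam : ℝ) (S : ℝ → X → X) : Prop :=
  ∀ u v : X, ∀ h : ℝ, 0 ≤ h →
    dist (S h u) v ^ 2 ≤ expMean (lam * h) * dist u v ^ 2 + 2 * h * (F v - F (S h u))

lemma SatisfiesOneStepEVI.satisfiesEVI (hstep : SatisfiesOneStepEVI F lam S)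
    (hadd : ∀ t h, 0 ≤ t → 0 ≤ h → ∀ u, S (t + h) u = S h (S t u))
    (hF : ∀ u, Tendsto (fun h => F (S h u)) (𝓝[>] 0) (𝓝 (F u))) :
    SatisfiesEVI F lam S := by
  intro u v t ht
  set x := S t u
  have hquot : ∀ᶠ h in 𝓝[>] (0 : ℝ), (dist (S (t + h) u) v ^ 2 - dist x v ^ 2) / h ≤
      (expMean (lam * h) - 1) / h * dist x v ^ 2 + 2 * (F v - F (S h x)) := by
    filter_upwards [self_mem_nhdsWithin] with h (hh : 0 < h)
    rw [hadd t h ht hh.le, div_le_iff₀ hh, add_mul, mul_right_comm, div_mul_cancel₀ _ hh.ne']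
    linarith [hstep x v h hh.le]
  have hlim : Tendsto (fun h => (expMean (lam * h) - 1) / h * dist x v ^ 2 +
      2 * (F v - F (S h x))) (𝓝[>] 0) (𝓝 (-lam * dist x v ^ 2 + 2 * (F v - F x))) :=
    ((tendsto_expMean_sub_one_div lam).mul_const _).add (((hF x).const_sub _).const_mul 2)
  have hupper : upperRightDeriv (fun r => dist (S r u) v ^ 2) t ≤
      ((-lam * dist x v ^ 2 + 2 * (F v - F x) : ℝ) : EReal) := by
    rw [← ((continuous_coe_real_ereal.tendsto _).comp hlim).limsup_eq]
    exact limsup_le_limsup (hquot.mono fun h hh => EReal.coe_le_coe_iff.2 hh)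
  have hhalf := mul_le_mul_of_nonneg_left hupper
    (EReal.coe_nonneg.2 (by norm_num : (0 : ℝ) ≤ 1 / 2))
  rw [← EReal.coe_mul] at hhalf
  refine (add_le_add_left hhalf _).trans_eq ?_
  rw [← EReal.coe_add]
  congr 1
  ring

/-- A point on a minimal geodesic minimises the combination of squared distances to the endpoints,
so a step of the flow cannot decrease that combination; the two one-step inequalities then bound
`F` after the step. -/
lemma SatisfiesOneStepEVI.geodesicallyConvex (hstep : SatisfiesOneStepEVI F lam S)
    (hF : ∀ u, Tendsto (fun h => F (S h u)) (𝓝[>] 0) (𝓝 (F u))) :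
    GeodesicallyConvex F lam := by
  intro γ hγ s hs
  set D := dist (γ 0) (γ 1)
  have hd0 : dist (γ s) (γ 0) = s * D := by
    rw [hγ s hs 0 (left_mem_Icc.2 zero_le_one), sub_zero, abs_of_nonneg hs.1]
  have hd1 : dist (γ s) (γ 1) = (1 - s) * D := by
    rw [hγ s hs 1 (right_mem_Icc.2 zero_le_one), abs_sub_comm, abs_of_nonneg (sub_nonneg.2 hs.2)]
  have hbound : ∀ᶠ h in 𝓝[>] (0 : ℝ), F (S h (γ s)) ≤ (1 - s) * F (γ 0) + s * F (γ 1) +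
      s * (1 - s) / 2 * D ^ 2 * ((expMean (lam * h) - 1) / h) := by
    filter_upwards [self_mem_nhdsWithin] with h (hh : 0 < h)
    have h0 := hstep (γ s) (γ 0) h hh.le
    have h1 := hstep (γ s) (γ 1) h hh.le
    rw [hd0] at h0
    rw [hd1] at h1
    set a := dist (S h (γ s)) (γ 0)
    set b := dist (S h (γ s)) (γ 1)
    have hmin : s * (1 - s) * D ^ 2 ≤ (1 - s) * a ^ 2 + s * b ^ 2 := by
      have htri : D ≤ a + b := dist_triangle_left _ _ _
      have hD : D ^ 2 ≤ (a + b) ^ 2 := pow_le_pow_left₀ dist_nonneg htri 2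
      nlinarith [sq_nonneg ((1 - s) * a - s * b), mul_nonneg hs.1 (sub_nonneg.2 hs.2)]
    have hsum := add_le_add (mul_le_mul_of_nonneg_left h0 (sub_nonneg.2 hs.2))
      (mul_le_mul_of_nonneg_left h1 hs.1)
    refine le_of_mul_le_mul_left ?_ (by positivity : 0 < 2 * h)
    have hcancel : 2 * h * (s * (1 - s) / 2 * D ^ 2 * ((expMean (lam * h) - 1) / h)) =
        s * (1 - s) * D ^ 2 * (expMean (lam * h) - 1) := by field_simp
    rw [mul_add, hcancel]
    linarith
  have hlim := ((tendsto_expMean_sub_one_div lam).const_mul (s * (1 - s) / 2 * D ^ 2)).const_add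
    ((1 - s) * F (γ 0) + s * F (γ 1))
  linarith [le_of_tendsto_of_tendsto (hF (γ s)) hlim hbound]

end Metric

section Reparametrization

lemma exists_strictMono_hasDerivAt_inv {v : ℝ → ℝ} (hv : Continuous v) {m : ℝ} (hm : 0 < m)
    (hmv : ∀ s, m ≤ v s) (hint : ∫ s in (0 : ℝ)..1, v s = 1) :
    ∃ φ : ℝ → ℝ, φ 0 = 0 ∧ φ 1 = 1 ∧ StrictMono φ ∧ ∀ s, HasDerivAt φ (v (φ s))⁻¹ s := by
  set σ : ℝ → ℝ := fun s => ∫ r in (0 : ℝ)..s, v r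
  have hσ (s : ℝ) : HasDerivAt σ (v s) s := hv.integral_hasStrictDerivAt 0 s |>.hasDerivAt
  have hσ0 : σ 0 = 0 := intervalIntegral.integral_same
  have hmono : StrictMono σ :=
    strictMono_of_deriv_pos fun s => (hσ s).deriv ▸ hm.trans_le (hmv s)
  have hmono' : Monotone fun s => σ s - m * s :=
    monotone_of_hasDerivAt_nonneg (fun s => (hσ s).sub ((hasDerivAt_id s).const_mul m))
      fun s => by simpa using hmv s
  have hsurj : Function.Surjective σ := by
    intro y
    have hy : 0 ≤ |y| / m := by positivity
    refine mem_range_of_exists_le_of_exists_ge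
      (continuous_iff_continuousAt.2 fun s => (hσ s).continuousAt)
      ⟨-(|y| / m), ?_⟩ ⟨|y| / m, ?_⟩
    · have := hmono' (neg_nonpos.2 hy)
      simp only [hσ0, mul_neg, mul_div_cancel₀ _ hm.ne', mul_zero] at this
      linarith [neg_abs_le y]
    · have := hmono' hy
      simp only [hσ0, mul_div_cancel₀ _ hm.ne', mul_zero] at this
      linarith [le_abs_self y]
  set e : ℝ ≃o ℝ := hmono.orderIsoOfSurjective σ hsurj
  have hright (s : ℝ) : σ (e.symm s) = s := e.apply_symm_apply s
  refine ⟨e.symm, hmono.injective ((hright 0).trans hσ0.symm),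
    hmono.injective ((hright 1).trans hint.symm), e.symm.strictMono, fun s => ?_⟩
  exact HasDerivAt.of_local_left_inverse e.symm.continuous.continuousAt (hσ _)
    (hm.trans_le (hmv _)).ne' (Eventually.of_forall hright)

/-- With `ε = k - ∫ p > 0`, the reparametrization `φ` is the inverse of `s ↦ k⁻¹ ∫₀ˢ (p + ε)`. -/
lemma exists_reparametrization_deriv_mul_le {p : ℝ → ℝ} {k : ℝ} (hp : ContinuousOn p (Icc 0 1))
    (hp0 : ∀ s ∈ Icc (0 : ℝ) 1, 0 ≤ p s) (hk : ∫ s in (0 : ℝ)..1, p s < k) :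
    ∃ φ : ℝ → ℝ, ContDiff ℝ 1 φ ∧ φ 0 = 0 ∧ φ 1 = 1 ∧ MapsTo φ (Icc 0 1) (Icc 0 1) ∧
      ∀ s ∈ Icc (0 : ℝ) 1, |deriv φ s| * p (φ s) ≤ k := by
  set q : ℝ → ℝ := IccExtend zero_le_one fun s : Icc (0 : ℝ) 1 => p s
  have hq : Continuous q := hp.domRestrict.Icc_extend'
  have hqp (s : ℝ) (hs : s ∈ Icc (0 : ℝ) 1) : q s = p s := IccExtend_of_mem _ _ hs
  have hq0 (s : ℝ) : 0 ≤ q s := hp0 _ (projIcc (0 : ℝ) 1 zero_le_one s).2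
  have hk0 : 0 < k := (intervalIntegral.integral_nonneg zero_le_one hp0).trans_lt hk
  set ε := k - ∫ s in (0 : ℝ)..1, q s with hε_def
  have hε : 0 < ε := by
    rw [hε_def, intervalIntegral.integral_congr fun s hs =>
      hqp s (uIcc_of_le (zero_le_one (α := ℝ)) ▸ hs)]
    exact sub_pos.2 hk
  have hpos (s : ℝ) : 0 < q s + ε := add_pos_of_nonneg_of_pos (hq0 s) hε
  obtain ⟨φ, hφ0, hφ1, hφ_mono, hφ⟩ := exists_strictMono_hasDerivAt_inv
    (v := fun s => (q s + ε) / k) (by fun_prop) (div_pos hε hk0)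
    (fun s => by gcongr; exact le_add_of_nonneg_left (hq0 s)) (by
      rw [intervalIntegral.integral_div, intervalIntegral.integral_add
        (hq.intervalIntegrable _ _) intervalIntegrable_const, intervalIntegral.integral_const,
        hε_def, sub_zero, one_smul, add_sub_cancel, div_self hk0.ne'])
  have hmaps : MapsTo φ (Icc 0 1) (Icc 0 1) := by
    have := (hφ_mono.monotone.monotoneOn (Icc 0 1)).mapsTo_Icc
    rwa [hφ0, hφ1] at this
  have hφ_cont : Continuous φ := continuous_iff_continuousAt.2 fun s => (hφ s).continuousAt
  refine ⟨φ, contDiff_one_iff_deriv.2 ⟨fun s => (hφ s).differentiableAt, ?_⟩, hφ0, hφ1, hmaps,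
    fun s hs => ?_⟩
  · rw [funext fun s => (hφ s).deriv]
    exact (((hq.comp hφ_cont).add continuous_const).div_const k).inv₀
      fun s => (div_pos (hpos _) hk0).ne'
  · rw [(hφ s).deriv, abs_of_pos (inv_pos.2 (div_pos (hpos _) hk0)), inv_div, ← hqp _ (hmaps hs),
      div_mul_eq_mul_div, div_le_iff₀ (hpos _)]
    gcongr
    exact le_add_of_nonneg_right hε.le

end Reparametrization

section Riemannian

variable {E : Type*} [NormedAddCommGroup E] [NormedSpace ℝ E]
  {X : Type*} [TopologicalSpace X] [ChartedSpace E X] {γ : ℝ → X}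

variable (E) in
/-- The velocity at the parameter `s` of a curve `γ` defined on the interval `J`. -/
def velocityWithin (γ : ℝ → X) (J : Set ℝ) (s : ℝ) : TangentSpace 𝓘(ℝ, E) (γ s) :=
  mfderivWithin 𝓘(ℝ, ℝ) 𝓘(ℝ, E) γ J s (1 : ℝ)

lemma velocityWithin_congr {γ γ' : ℝ → X} {J : Set ℝ} {s : ℝ} (h : EqOn γ γ' J) (hs : s ∈ J) :
    (velocityWithin E γ J s : E) = velocityWithin E γ' J s :=
  congrArg (fun L : ℝ →L[ℝ] E => L 1) (mfderivWithin_congr h (h hs))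

lemma velocityWithin_comp {φ : ℝ → ℝ} {φ' s : ℝ} {J J' : Set ℝ}
    (hγ : MDifferentiableWithinAt 𝓘(ℝ, ℝ) 𝓘(ℝ, E) γ J (φ s)) (hφ : HasDerivWithinAt φ φ' J' s)
    (hmaps : MapsTo φ J' J) (hJ' : UniqueDiffWithinAt ℝ J' s) :
    velocityWithin E (γ ∘ φ) J' s = φ' • velocityWithin E γ J (φ s) := by
  have h := (HasMFDerivWithinAt.comp s hγ.hasMFDerivWithinAt
    hφ.hasFDerivWithinAt.hasMFDerivWithinAt hmaps).mfderivWithin hJ'.uniqueMDiffWithinAt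
  refine (congrArg (fun L : ℝ →L[ℝ] E => L 1) h).trans ?_
  set L : ℝ →L[ℝ] E := mfderivWithin 𝓘(ℝ, ℝ) 𝓘(ℝ, E) γ J (φ s)
  change L ((1 : ℝ) • φ') = φ' • L 1
  rw [one_smul, ← map_smul, smul_eq_mul, mul_one]

variable [IsManifold 𝓘(ℝ, E) 1 X] [RiemannianBundle (fun x : X => TangentSpace 𝓘(ℝ, E) x)]
  [IsContinuousRiemannianBundle E (fun x : X => TangentSpace 𝓘(ℝ, E) x)]

lemma continuousOn_norm_velocityWithin {J : Set ℝ} (hJ : UniqueDiffOn ℝ J)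
    (hγ : ContMDiffOn 𝓘(ℝ, ℝ) 𝓘(ℝ, E) 1 γ J) :
    ContinuousOn (fun s => ‖velocityWithin E γ J s‖) J := by
  have hone : Continuous fun s : ℝ => (⟨s, (1 : ℝ)⟩ : TangentBundle 𝓘(ℝ, ℝ) ℝ) :=
    (contMDiff_vectorSpace_iff_contDiff.2 contDiff_const : ContMDiff 𝓘(ℝ, ℝ) 𝓘(ℝ, ℝ).tangent 0
      fun s : ℝ => (⟨s, (1 : ℝ)⟩ : TangentBundle 𝓘(ℝ, ℝ) ℝ)).continuous
  have hlift : ContinuousOn (fun s => (⟨γ s, velocityWithin E γ J s⟩ :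
      TotalSpace E (fun x : X => TangentSpace 𝓘(ℝ, E) x))) J :=
    (hγ.continuousOn_tangentMapWithin le_rfl hJ.uniqueMDiffOn).comp hone.continuousOn
      fun s hs => hs
  have hinner := hlift.inner_bundle (E := fun x : X => TangentSpace 𝓘(ℝ, E) x) (b := γ) hlift
  simpa only [real_inner_self_eq_norm_sq, Real.sqrt_sq (norm_nonneg _)] using hinner.sqrt

lemma pathELength_eq_ofReal_integral (hγ : ContMDiffOn 𝓘(ℝ, ℝ) 𝓘(ℝ, E) 1 γ (Icc 0 1)) :
    pathELength 𝓘(ℝ, E) γ 0 1 =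
      ENNReal.ofReal (∫ s in (0 : ℝ)..1, ‖velocityWithin E γ (Icc 0 1) s‖) := by
  have hint := (continuousOn_norm_velocityWithin (uniqueDiffOn_Icc zero_lt_one)
    hγ).integrableOn_Icc (μ := MeasureTheory.volume)
  rw [pathELength_eq_lintegral_mfderivWithin_Icc, intervalIntegral.integral_of_le zero_le_one,
    ← MeasureTheory.integral_Icc_eq_integral_Ioc,
    MeasureTheory.ofReal_integral_eq_lintegral_ofReal hint (.of_forall fun _ => norm_nonneg _)]
  simp only [ofReal_norm]
  rfl

end Riemannian

section RiemannianDistance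

variable {E : Type*} [NormedAddCommGroup E] [NormedSpace ℝ E]
  {X : Type*} [MetricSpace X] [ChartedSpace E X] [IsManifold 𝓘(ℝ, E) 1 X]
  [RiemannianBundle (fun x : X => TangentSpace 𝓘(ℝ, E) x)]
  [IsContinuousRiemannianBundle E (fun x : X => TangentSpace 𝓘(ℝ, E) x)]
  [IsRiemannianManifold 𝓘(ℝ, E) X] {γ : ℝ → X}

lemma dist_le_integral_norm_velocityWithin (hγ : ContMDiffOn 𝓘(ℝ, ℝ) 𝓘(ℝ, E) 1 γ (Icc 0 1)) :
    dist (γ 0) (γ 1) ≤ ∫ s in (0 : ℝ)..1, ‖velocityWithin E γ (Icc 0 1) s‖ := by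
  have hlength : edist (γ 0) (γ 1) ≤ pathELength 𝓘(ℝ, E) γ 0 1 := by
    rw [IsRiemannianManifold.out (I := 𝓘(ℝ, E)) (γ 0) (γ 1)]
    exact riemannianEDist_le_pathELength hγ rfl rfl zero_le_one
  rwa [pathELength_eq_ofReal_integral hγ, edist_dist, ENNReal.ofReal_le_ofReal_iff
    (intervalIntegral.integral_nonneg zero_le_one fun _ _ => norm_nonneg _)] at hlength

lemma dist_sq_le_integral (hγ : ContMDiffOn 𝓘(ℝ, ℝ) 𝓘(ℝ, E) 1 γ (Icc 0 1)) {g : ℝ → ℝ}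
    (hg : ContinuousOn g (Icc 0 1))
    (hγg : ∀ s ∈ Icc (0 : ℝ) 1, ‖velocityWithin E γ (Icc 0 1) s‖ ^ 2 ≤ g s) :
    dist (γ 0) (γ 1) ^ 2 ≤ ∫ s in (0 : ℝ)..1, g s := by
  set d := dist (γ 0) (γ 1)
  have hspeed : IntervalIntegrable (fun s => ‖velocityWithin E γ (Icc 0 1) s‖)
      MeasureTheory.volume 0 1 :=
    (continuousOn_norm_velocityWithin (uniqueDiffOn_Icc zero_lt_one)
      hγ).intervalIntegrable_of_Icc zero_le_one
  have hgi : IntervalIntegrable g MeasureTheory.volume 0 1 :=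
    hg.intervalIntegrable_of_Icc zero_le_one
  have hyoung : ∫ s in (0 : ℝ)..1, 2 * d * ‖velocityWithin E γ (Icc 0 1) s‖ ≤
      ∫ s in (0 : ℝ)..1, (d ^ 2 + g s) :=
    intervalIntegral.integral_mono_on zero_le_one (hspeed.const_mul _)
      (intervalIntegrable_const.add hgi) fun s hs =>
        (two_mul_le_add_sq _ _).trans (by gcongr; exact hγg s hs)
  rw [intervalIntegral.integral_const_mul, intervalIntegral.integral_add intervalIntegrable_const
    hgi, intervalIntegral.integral_const, sub_zero, one_smul] at hyoung
  nlinarith [dist_le_integral_norm_velocityWithin hγ,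
    (dist_nonneg : 0 ≤ dist (γ 0) (γ 1))]

variable (E) in
lemma exists_curve_norm_velocityWithin_le {x y : X} {k : ℝ} (hk : dist x y < k) :
    ∃ γ : ℝ → X, ContMDiffOn 𝓘(ℝ, ℝ) 𝓘(ℝ, E) 1 γ (Icc 0 1) ∧ γ 0 = x ∧ γ 1 = y ∧
      ∀ s ∈ Icc (0 : ℝ) 1, ‖velocityWithin E γ (Icc 0 1) s‖ ≤ k := by
  have hk0 : 0 < k := dist_nonneg.trans_lt hk
  obtain ⟨c, hc0, hc1, hc, hlt⟩ : ∃ c : ℝ → X, c 0 = x ∧ c 1 = y ∧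
      ContMDiffOn 𝓘(ℝ, ℝ) 𝓘(ℝ, E) 1 c (Icc 0 1) ∧
      pathELength 𝓘(ℝ, E) c 0 1 < ENNReal.ofReal k := by
    apply exists_lt_of_riemannianEDist_lt
    rwa [← IsRiemannianManifold.out (I := 𝓘(ℝ, E)) x y, edist_dist,
      ENNReal.ofReal_lt_ofReal_iff hk0]
  rw [pathELength_eq_ofReal_integral hc, ENNReal.ofReal_lt_ofReal_iff hk0] at hlt
  obtain ⟨φ, hφ, hφ0, hφ1, hmaps, hφc⟩ := exists_reparametrization_deriv_mul_le
    (continuousOn_norm_velocityWithin (uniqueDiffOn_Icc zero_lt_one) hc)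
    (fun _ _ => norm_nonneg _) hlt
  refine ⟨c ∘ φ, hc.comp hφ.contMDiff.contMDiffOn hmaps, by simp [hφ0, hc0], by simp [hφ1, hc1],
    fun s hs => ?_⟩
  have hvel : velocityWithin E (c ∘ φ) (Icc 0 1) s =
      deriv φ s • velocityWithin E c (Icc 0 1) (φ s) :=
    velocityWithin_comp (hc.mdifferentiableOn one_ne_zero _ (hmaps hs))
      (hφ.differentiable one_ne_zero s).hasDerivAt.hasDerivWithinAt hmaps
      (uniqueDiffOn_Icc zero_lt_one s hs)
  rw [hvel]
  exact (norm_smul _ _).trans_le (hφc s hs)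

end RiemannianDistance

section Flow

variable {E : Type*} [NormedAddCommGroup E] [NormedSpace ℝ E]
  {X : Type*} [TopologicalSpace X] [ChartedSpace E X] {S : ℝ → X → X} {γ : ℝ → X}

variable (E) in
/-- The velocity at time zero of the trajectories of `S`. It is a tangent vector at `S 0 x`, which
for a semigroup is `x`. -/
def generator (S : ℝ → X → X) (x : X) : TangentSpace 𝓘(ℝ, E) x :=
  velocityWithin E (fun t => S t x) (Ici 0) 0

variable (E) in
/-- The differential at `x` of the map `S t`. -/
def flowDifferential (S : ℝ → X → X) (t : ℝ) (x : X) :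
    TangentSpace 𝓘(ℝ, E) x →L[ℝ] TangentSpace 𝓘(ℝ, E) (S t x) :=
  mfderiv 𝓘(ℝ, E) 𝓘(ℝ, E) (S t) x

namespace IsSmoothSemigroup

lemma contMDiffOn_trajectory (hS : IsSmoothSemigroup E S) (x : X) :
    ContMDiffOn 𝓘(ℝ, ℝ) 𝓘(ℝ, E) ∞ (fun t => S t x) (Ici 0) :=
  hS.smooth.comp (f := fun t : ℝ => (t, x)) (contMDiff_id.prodMk contMDiff_const).contMDiffOn
    fun _ ht => ⟨ht, mem_univ _⟩

lemma contMDiff_map (hS : IsSmoothSemigroup E S) {t : ℝ} (ht : 0 ≤ t) :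
    ContMDiff 𝓘(ℝ, E) 𝓘(ℝ, E) ∞ (S t) := by
  rw [← contMDiffOn_univ]
  exact hS.smooth.comp (f := fun x : X => (t, x))
    (contMDiff_const.prodMk contMDiff_id).contMDiffOn fun x _ => ⟨ht, mem_univ x⟩

lemma contMDiffOn_deform (hS : IsSmoothSemigroup E S) {n : ℕ∞ω} (hn : n ≤ ∞)
    (hγ : ContMDiffOn 𝓘(ℝ, ℝ) 𝓘(ℝ, E) n γ (Icc 0 1)) {t : ℝ} (ht : 0 ≤ t) :
    ContMDiffOn 𝓘(ℝ, ℝ) 𝓘(ℝ, E) n (deform S γ t) (Icc 0 1) :=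
  (hS.smooth.of_le hn).comp (f := fun s : ℝ => (s * t, γ s))
    ((contDiff_id.mul contDiff_const).contMDiff.contMDiffOn.prodMk hγ)
    fun _ hs => ⟨mul_nonneg hs.1 ht, mem_univ _⟩

lemma tendsto_comp_trajectory (hS : IsSmoothSemigroup E S) {Y : Type*} [TopologicalSpace Y]
    {F : X → Y} (hF : Continuous F) (x : X) :
    Tendsto (fun t => F (S t x)) (𝓝[>] 0) (𝓝 (F x)) := by
  have h : Tendsto (fun t => S t x) (𝓝[>] 0) (𝓝 (S 0 x)) :=
    ((hS.contMDiffOn_trajectory x).continuousOn 0 self_mem_Ici).mono_left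
      (nhdsWithin_mono 0 Ioi_subset_Ici_self)
  rw [hS.zero] at h
  exact (hF.tendsto x).comp h

lemma deform_zero (hS : IsSmoothSemigroup E S) (γ : ℝ → X) : deform S γ 0 = γ :=
  funext fun s => by rw [deform, mul_zero, hS.zero]

lemma deform_deform (hS : IsSmoothSemigroup E S) {t h s : ℝ} (ht : 0 ≤ t) (hh : 0 ≤ h)
    (hs : s ∈ Icc (0 : ℝ) 1) : deform S (deform S γ t) h s = deform S γ (t + h) s := by
  rw [deform, deform, deform, mul_add, hS.add _ _ (mul_nonneg hs.1 ht) (mul_nonneg hs.1 hh)]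

lemma isMIntegralCurveOn_generator (hS : IsSmoothSemigroup E S) (x : X) :
    IsMIntegralCurveOn (I := 𝓘(ℝ, E)) (fun t => S t x) (generator E S) (Ici 0) := by
  intro t ht
  have hd := (hS.contMDiffOn_trajectory x).mdifferentiableOn (by simp) t ht
  have hshift : velocityWithin E ((fun r => S r x) ∘ fun h => t + h) (Ici 0) 0 =
      (1 : ℝ) • velocityWithin E (fun r => S r x) (Ici 0) (t + 0) :=
    velocityWithin_comp (φ := fun h => t + h) (by rwa [add_zero])
      ((hasDerivWithinAt_id (0 : ℝ) (Ici 0)).const_add t)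
      (fun h hh => show 0 ≤ t + h from add_nonneg ht hh) (uniqueDiffOn_Ici 0 0 self_mem_Ici)
  have hadd : (generator E S (S t x) : E) =
      velocityWithin E ((fun r => S r x) ∘ fun h => t + h) (Ici 0) 0 :=
    velocityWithin_congr (γ := fun h => S h (S t x)) (fun h hh => (hS.add t h ht hh x).symm)
      self_mem_Ici
  have hbase : (velocityWithin E (fun r => S r x) (Ici 0) (t + 0) : E) =
      velocityWithin E (fun r => S r x) (Ici 0) t :=
    congrArg (fun r => (velocityWithin E (fun r => S r x) (Ici 0) r : E)) (add_zero t :)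
  have hgen : (generator E S (S t x) : E) = velocityWithin E (fun r => S r x) (Ici 0) t :=
    hadd.trans (hshift.trans ((one_smul ℝ (_ : E)).trans hbase))
  exact hd.hasMFDerivWithinAt.congr_mfderiv
    (ContinuousLinearMap.ext_ring (hgen.symm.trans (one_smul ℝ (_ : E)).symm))

lemma hasMFDerivWithinAt_flow (hS : IsSmoothSemigroup E S) {t : ℝ} (ht : 0 ≤ t) (x : X) :
    HasMFDerivWithinAt (𝓘(ℝ, ℝ).prod 𝓘(ℝ, E)) 𝓘(ℝ, E) (fun p : ℝ × X => S p.1 p.2)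
      (Ici 0 ×ˢ univ) (t, x)
      (((1 : ℝ →L[ℝ] ℝ).smulRight (generator E S (S t x))).coprod (flowDifferential E S t x)) := by
  have hL := (hS.smooth.mdifferentiableOn (by simp) (t, x) ⟨ht, mem_univ _⟩).hasMFDerivWithinAt
  set L : ℝ × E →L[ℝ] E := mfderivWithin (𝓘(ℝ, ℝ).prod 𝓘(ℝ, E)) 𝓘(ℝ, E)
    (fun p : ℝ × X => S p.1 p.2) (Ici 0 ×ˢ univ) (t, x)
  have htime : L.comp (.inl ℝ ℝ E) = (1 : ℝ →L[ℝ] ℝ).smulRight (generator E S (S t x)) :=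
    (uniqueDiffOn_Ici (0 : ℝ) t ht).uniqueMDiffWithinAt.eq
      (HasMFDerivWithinAt.comp t hL
        ((hasMFDerivWithinAt_id (I := 𝓘(ℝ, ℝ)) (Ici 0) t).prodMk (hasMFDerivWithinAt_const x _ _))
        fun r hr => mk_mem_prod hr (mem_univ _)) (hS.isMIntegralCurveOn_generator x t ht)
  have hincl : HasMFDerivWithinAt 𝓘(ℝ, E) (𝓘(ℝ, ℝ).prod 𝓘(ℝ, E)) (fun y : X => (t, y)) univ x
      (.inr ℝ ℝ E) :=
    (hasMFDerivWithinAt_const t _ _).prodMk (hasMFDerivWithinAt_id (I := 𝓘(ℝ, E)) univ x)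
  have hspace : L.comp (.inr ℝ ℝ E) = flowDifferential E S t x :=
    (uniqueMDiffWithinAt_univ 𝓘(ℝ, E)).eq
      (hL.comp x hincl fun y _ => mk_mem_prod ht (mem_univ _) :)
      ((hS.contMDiff_map ht).mdifferentiable (by simp) x).hasMFDerivAt.hasMFDerivWithinAt
  exact hL.congr_mfderiv (ContinuousLinearMap.prod_ext
    (htime.trans (ContinuousLinearMap.coprod_comp_inl _ _).symm)
    (hspace.trans (ContinuousLinearMap.coprod_comp_inr _ _).symm))

lemma velocityWithin_deform (hS : IsSmoothSemigroup E S) {J : Set ℝ} {s t : ℝ}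
    (hJ : UniqueDiffWithinAt ℝ J s) (hJ0 : J ⊆ Ici 0) (hs : s ∈ J) (ht : 0 ≤ t)
    (hγ : MDifferentiableWithinAt 𝓘(ℝ, ℝ) 𝓘(ℝ, E) γ J s) :
    velocityWithin E (deform S γ t) J s = (t • generator E S (S (s * t) (γ s)) +
      flowDifferential E S (s * t) (γ s) (velocityWithin E γ J s) :
        TangentSpace 𝓘(ℝ, E) (S (s * t) (γ s))) := by
  have hmul : HasMFDerivWithinAt 𝓘(ℝ, ℝ) 𝓘(ℝ, ℝ) (fun r : ℝ => r * t) J s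
      (t • ContinuousLinearMap.id ℝ ℝ) :=
    ((hasFDerivWithinAt_id s J).mul_const t).hasMFDerivWithinAt
  have h := (HasMFDerivWithinAt.comp s
    (hS.hasMFDerivWithinAt_flow (mul_nonneg (hJ0 hs) ht) (γ s))
    (hmul.prodMk hγ.hasMFDerivWithinAt)
    fun r hr => mk_mem_prod (mul_nonneg (hJ0 hr) ht) (mem_univ _)).mfderivWithin
      hJ.uniqueMDiffWithinAt
  refine (congrArg (fun L : ℝ →L[ℝ] E => L 1) h).trans ?_
  exact congrArg (fun r : ℝ => (r • generator E S (S (s * t) (γ s)) +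
    flowDifferential E S (s * t) (γ s) (velocityWithin E γ J s) :
      TangentSpace 𝓘(ℝ, E) (S (s * t) (γ s)))) (mul_one t)

lemma flowDifferential_zero (hS : IsSmoothSemigroup E S) (x : X) (w : TangentSpace 𝓘(ℝ, E) x) :
    (flowDifferential E S 0 x w : E) = w := by
  have hid : S 0 = id := funext hS.zero
  exact congrArg (fun L : E →L[ℝ] E => L w) <|
    (congrArg (fun f : X → X => (mfderiv 𝓘(ℝ, E) 𝓘(ℝ, E) f x : E →L[ℝ] E)) hid).trans mfderiv_id

lemma flowDifferential_add (hS : IsSmoothSemigroup E S) {t h : ℝ} (ht : 0 ≤ t) (hh : 0 ≤ h)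
    (x : X) (w : TangentSpace 𝓘(ℝ, E) x) :
    (flowDifferential E S (t + h) x w : E) =
      flowDifferential E S h (S t x) (flowDifferential E S t x w) := by
  have hcomp : S (t + h) = S h ∘ S t := funext (hS.add t h ht hh)
  have hmap {r : ℝ} (hr : 0 ≤ r) (y : X) := (hS.contMDiff_map hr).mdifferentiable (by simp) y
  exact congrArg (fun L : E →L[ℝ] E => L w) <|
    (congrArg (fun f : X → X => (mfderiv 𝓘(ℝ, E) 𝓘(ℝ, E) f x : E →L[ℝ] E)) hcomp).trans
      (mfderiv_comp x (hmap hh _) (hmap ht x))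

end IsSmoothSemigroup

end Flow

section Curve

variable {E : Type*} [NormedAddCommGroup E] [NormedSpace ℝ E]
  {X : Type*} [TopologicalSpace X] [ChartedSpace E X] {γ : ℝ → X}

lemma derivWithin_comp_eq_mvfderiv {F : X → ℝ} {J : Set ℝ} {s : ℝ}
    (hF : MDifferentiableAt 𝓘(ℝ, E) 𝓘(ℝ, ℝ) F (γ s))
    (hγ : MDifferentiableWithinAt 𝓘(ℝ, ℝ) 𝓘(ℝ, E) γ J s) (hJ : UniqueDiffWithinAt ℝ J s) :
    derivWithin (fun σ => F (γ σ)) J s =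
      mvfderiv 𝓘(ℝ, E) F (γ s) (velocityWithin E γ J s) := by
  have h := mfderiv_comp_mfderivWithin s hF hγ hJ.uniqueMDiffWithinAt
  rw [mfderivWithin_eq_fderivWithin] at h
  exact congrArg (fun L : ℝ →L[ℝ] ℝ => L 1) h

lemma exists_contDiff_hasDerivAt_norm_sub_lt (x v : E) (s : ℝ) {δ : ℝ} (hδ : 0 < δ) :
    ∃ c : ℝ → E, ContDiff ℝ ∞ c ∧ c s = x ∧ HasDerivAt c v s ∧ ∀ r, ‖c r - x‖ < δ := by
  set ε := δ / (‖v‖ + 1)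
  have hε : 0 < ε := by positivity
  have hsin : HasDerivAt (fun r => ε * Real.sin ((r - s) / ε)) 1 s := by
    have := ((((hasDerivAt_id s).sub_const s).div_const ε).sin).const_mul ε
    simpa [hε.ne'] using! this
  refine ⟨fun r => x + (ε * Real.sin ((r - s) / ε)) • v, by fun_prop, by simp,
    ((hsin.smul_const v).const_add x).congr_deriv (one_smul ℝ v), fun r => ?_⟩
  rw [add_sub_cancel_left, norm_smul, norm_mul, Real.norm_of_nonneg hε.le]
  calc ε * ‖Real.sin ((r - s) / ε)‖ * ‖v‖ ≤ ε * 1 * ‖v‖ := by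
        gcongr; exact Real.abs_sin_le_one _
    _ < ε * 1 * (‖v‖ + 1) := by gcongr; exact lt_add_one _
    _ = δ := by rw [mul_one, div_mul_cancel₀ _ (by positivity)]

lemma exists_curve_velocityWithin_eq [IsManifold 𝓘(ℝ, E) ∞ X] (x : X)
    (w : TangentSpace 𝓘(ℝ, E) x) {s : ℝ} (hs : s ∈ Icc (0 : ℝ) 1) :
    ∃ γ : ℝ → X, ContMDiffOn 𝓘(ℝ, ℝ) 𝓘(ℝ, E) ∞ γ (Icc 0 1) ∧ γ s = x ∧
      (velocityWithin E γ (Icc 0 1) s : E) = w := by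
  let v : E := w
  set φ := extChartAt 𝓘(ℝ, E) x
  obtain ⟨δ, hδ, hball⟩ := Metric.mem_nhds_iff.1 (extChartAt_target_mem_nhds (I := 𝓘(ℝ, E)) x)
  obtain ⟨c, hcsmooth, hcs, hcderiv, hcδ⟩ :=
    exists_contDiff_hasDerivAt_norm_sub_lt (φ x) v s hδ
  have hctarget (r : ℝ) : c r ∈ φ.target := hball (mem_ball_iff_norm.2 (hcδ r))
  have hchart : HasMFDerivAt 𝓘(ℝ, E) 𝓘(ℝ, E) φ.symm (c s) (ContinuousLinearMap.id ℝ E) := by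
    have h := (mdifferentiableWithinAt_extChartAt_symm (I := 𝓘(ℝ, E))
      (mem_extChartAt_target x)).hasMFDerivWithinAt
    rw [mfderivWithin_range_extChartAt_symm, ModelWithCorners.range_eq_univ] at h
    rw [hcs]
    exact hasMFDerivWithinAt_univ.1 h
  refine ⟨φ.symm ∘ c, (contMDiffOn_extChartAt_symm x).comp hcsmooth.contMDiff.contMDiffOn
    fun r _ => hctarget r, by simp [hcs, φ], ?_⟩
  have hvel := (hchart.comp_hasMFDerivWithinAt s
    hcderiv.hasDerivWithinAt.hasFDerivWithinAt.hasMFDerivWithinAt).mfderivWithin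
      (uniqueDiffOn_Icc zero_lt_one s hs).uniqueMDiffWithinAt
  exact (congrArg (fun L : ℝ →L[ℝ] E => L 1) hvel).trans (one_smul ℝ v)

end Curve

section RiemannianFlow

variable {E : Type*} [NormedAddCommGroup E] [NormedSpace ℝ E]
  {X : Type*} [TopologicalSpace X] [ChartedSpace E X] [IsManifold 𝓘(ℝ, E) ∞ X]
  {S : ℝ → X → X}

namespace IsSmoothSemigroup

lemma contMDiffOn_generator_add_flowDifferential (hS : IsSmoothSemigroup E S) (r : ℝ) {x : X}
    (w : TangentSpace 𝓘(ℝ, E) x) :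
    ContMDiffOn 𝓘(ℝ, ℝ) (𝓘(ℝ, E).prod 𝓘(ℝ, E)) ∞ (fun t =>
      (⟨S t x, r • generator E S (S t x) + flowDifferential E S t x w⟩ :
        TotalSpace E (fun x : X => TangentSpace 𝓘(ℝ, E) x))) (Ici 0) := by
  have hconst : ContMDiff 𝓘(ℝ, ℝ) ((𝓘(ℝ, ℝ).prod 𝓘(ℝ, E)).tangent) ∞ (fun t : ℝ =>
      (⟨(t, x), (r, w)⟩ : TangentBundle (𝓘(ℝ, ℝ).prod 𝓘(ℝ, E)) (ℝ × X))) :=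
    contMDiff_equivTangentBundleProd_symm.comp
      (ContMDiff.prodMk (g := fun _ => (⟨x, w⟩ : TangentBundle 𝓘(ℝ, E) X))
        (f := fun t : ℝ => (⟨t, r⟩ : TangentBundle 𝓘(ℝ, ℝ) ℝ))
        (contMDiff_vectorSpace_iff_contDiff.2 contDiff_const) contMDiff_const)
  have hunique : UniqueMDiffOn (𝓘(ℝ, ℝ).prod 𝓘(ℝ, E)) (Ici (0 : ℝ) ×ˢ (univ : Set X)) :=
    (uniqueDiffOn_Ici 0).uniqueMDiffOn.prod uniqueMDiffOn_univ
  refine ((hS.smooth.contMDiffOn_tangentMapWithin (m := ∞) (by simp) hunique).comp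
    hconst.contMDiffOn fun t ht => ⟨ht, mem_univ x⟩).congr fun t ht => ?_
  have hderiv := (hS.hasMFDerivWithinAt_flow ht x).mfderivWithin (hunique (t, x) ⟨ht, mem_univ x⟩)
  exact congrArg (fun L : ℝ × E →L[ℝ] E => (⟨S t x, L (r, w)⟩ :
    TotalSpace E (fun x : X => TangentSpace 𝓘(ℝ, E) x))) hderiv.symm

variable [RiemannianBundle (fun x : X => TangentSpace 𝓘(ℝ, E) x)]
  [IsContMDiffRiemannianBundle 𝓘(ℝ, E) ∞ E (fun x : X => TangentSpace 𝓘(ℝ, E) x)]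

lemma contDiffOn_inner_flow (hS : IsSmoothSemigroup E S) (r r' : ℝ) {x : X}
    (w w' : TangentSpace 𝓘(ℝ, E) x) :
    ContDiffOn ℝ ∞ (fun t => inner ℝ (r • generator E S (S t x) + flowDifferential E S t x w)
      (r' • generator E S (S t x) + flowDifferential E S t x w')) (Ici 0) := by
  have h := ContMDiffOn.inner_bundle (E := fun x : X => TangentSpace 𝓘(ℝ, E) x)
    (b := fun t => S t x)
    (v := fun t => r • generator E S (S t x) + flowDifferential E S t x w)
    (w := fun t => r' • generator E S (S t x) + flowDifferential E S t x w')
    (hS.contMDiffOn_generator_add_flowDifferential r w)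
    (hS.contMDiffOn_generator_add_flowDifferential r' w')
  exact contMDiffOn_iff_contDiffOn.1 h

lemma contDiffOn_norm_sq_flowDifferential (hS : IsSmoothSemigroup E S) {x : X}
    (w : TangentSpace 𝓘(ℝ, E) x) :
    ContDiffOn ℝ ∞ (fun t => ‖flowDifferential E S t x w‖ ^ 2) (Ici 0) := by
  simpa only [zero_smul, zero_add, real_inner_self_eq_norm_sq] using
    hS.contDiffOn_inner_flow 0 0 w w

lemma contDiffOn_inner_generator_flowDifferential (hS : IsSmoothSemigroup E S) {x : X}
    (w : TangentSpace 𝓘(ℝ, E) x) :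
    ContDiffOn ℝ ∞ (fun t => inner ℝ (generator E S (S t x)) (flowDifferential E S t x w))
      (Ici 0) := by
  simpa only [one_smul, map_zero, add_zero, zero_smul, zero_add] using
    hS.contDiffOn_inner_flow 1 0 0 w

lemma contDiffOn_norm_sq_generator (hS : IsSmoothSemigroup E S) (x : X) :
    ContDiffOn ℝ ∞ (fun t => ‖generator E S (S t x)‖ ^ 2) (Ici 0) := by
  simpa only [one_smul, map_zero, add_zero, real_inner_self_eq_norm_sq] using
    hS.contDiffOn_inner_flow 1 1 (0 : TangentSpace 𝓘(ℝ, E) x) 0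

end IsSmoothSemigroup

end RiemannianFlow

section Calculus

lemma derivWithin_Ici_const_add {f : ℝ → ℝ} {t : ℝ} (ht : 0 ≤ t)
    (hf : DifferentiableWithinAt ℝ f (Ici 0) t) :
    derivWithin (fun h => f (t + h)) (Ici 0) 0 = derivWithin f (Ici 0) t := by
  have hshift : HasDerivWithinAt f (derivWithin f (Ici 0) t) (Ici 0) (t + 0) := by
    simpa using hf.hasDerivWithinAt
  have hcomp := (hshift.comp (0 : ℝ) ((hasDerivWithinAt_id (0 : ℝ) (Ici 0)).const_add t)
    fun h hh => add_nonneg ht hh).derivWithin (uniqueDiffOn_Ici 0 0 self_mem_Ici)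
  exact hcomp.trans (mul_one _)

lemma hasDerivWithinAt_Ici_comp_const_mul {f : ℝ → ℝ} {s : ℝ} (hs : 0 ≤ s)
    (hf : DifferentiableWithinAt ℝ f (Ici 0) 0) :
    HasDerivWithinAt (fun r => f (s * r)) (s * derivWithin f (Ici 0) 0) (Ici 0) 0 := by
  have hscale : HasDerivWithinAt f (derivWithin f (Ici 0) 0) (Ici 0) (s * 0) := by
    simpa using hf.hasDerivWithinAt
  have hcomp := hscale.comp (0 : ℝ) ((hasDerivWithinAt_id (0 : ℝ) (Ici 0)).const_mul s)
    fun r hr => mul_nonneg hs hr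
  exact hcomp.congr_deriv (by rw [mul_one, mul_comm])

lemma le_exp_mul_of_derivWithin_le {f : ℝ → ℝ} {K : ℝ} (hf : DifferentiableOn ℝ f (Ici 0))
    (hfK : ∀ t, 0 ≤ t → derivWithin f (Ici 0) t ≤ K * f t) {t : ℝ} (ht : 0 ≤ t) :
    f t ≤ Real.exp (K * t) * f 0 := by
  have hexp (r : ℝ) : HasDerivAt (fun r => Real.exp (-(K * r))) (Real.exp (-(K * r)) * -K) r := by
    simpa using (((hasDerivAt_id r).const_mul K).neg).exp
  have hanti : AntitoneOn (fun r => Real.exp (-(K * r)) * f r) (Ici 0) := by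
    refine antitoneOn_of_hasDerivWithinAt_nonpos (convex_Ici 0)
      ((by fun_prop : Continuous fun r => Real.exp (-(K * r))).continuousOn.mul hf.continuousOn)
      (fun r hr => ((hexp r).hasDerivWithinAt.mul
        (hf r (interior_subset hr)).hasDerivWithinAt).mono interior_subset) fun r hr => ?_
    have := mul_le_mul_of_nonneg_left (hfK r (interior_subset hr)) (Real.exp_nonneg (-(K * r)))
    linarith
  have h := hanti self_mem_Ici ht ht
  simp only [mul_zero, neg_zero, Real.exp_zero, one_mul] at h
  rwa [Real.exp_neg, inv_mul_le_iff₀ (Real.exp_pos _)] at h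

end Calculus

section Action

variable {E : Type*} [NormedAddCommGroup E] [NormedSpace ℝ E]
  {X : Type*} [TopologicalSpace X] [ChartedSpace E X]
  [RiemannianBundle (fun x : X => TangentSpace 𝓘(ℝ, E) x)] {S : ℝ → X → X} {γ : ℝ → X}

lemma inner_tangent_congr {x y : X} (h : x = y) {v w : TangentSpace 𝓘(ℝ, E) x}
    {v' w' : TangentSpace 𝓘(ℝ, E) y} (hv : (v : E) = v') (hw : (w : E) = w') :
    inner ℝ v w = inner ℝ v' w' := by
  subst h
  rw [show v = v' from hv, show w = w' from hw]

lemma norm_tangent_congr {x y : X} (h : x = y) {v : TangentSpace 𝓘(ℝ, E) x}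
    {v' : TangentSpace 𝓘(ℝ, E) y} (hv : (v : E) = v') : ‖v‖ = ‖v'‖ := by
  subst h
  rw [show v = v' from hv]

namespace IsSmoothSemigroup

lemma action_zero (hS : IsSmoothSemigroup E S) (γ : ℝ → X) (s : ℝ) :
    action E S γ 0 s = ‖velocityWithin E γ (Icc 0 1) s‖ ^ 2 := by
  rw [action, hS.deform_zero]
  rfl

lemma action_deform (hS : IsSmoothSemigroup E S) (γ : ℝ → X) {t h s : ℝ} (ht : 0 ≤ t) (hh : 0 ≤ h)
    (hs : s ∈ Icc (0 : ℝ) 1) : action E S (deform S γ t) h s = action E S γ (t + h) s :=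
  congrArg (· ^ 2) <| norm_tangent_congr (hS.deform_deform ht hh hs) <|
    velocityWithin_congr (fun _ hσ => hS.deform_deform ht hh hσ) hs

lemma action_eq (hS : IsSmoothSemigroup E S) {s t : ℝ} (hs : s ∈ Icc (0 : ℝ) 1) (ht : 0 ≤ t)
    (hγ : MDifferentiableWithinAt 𝓘(ℝ, ℝ) 𝓘(ℝ, E) γ (Icc 0 1) s) :
    action E S γ t s =
      ‖flowDifferential E S (s * t) (γ s) (velocityWithin E γ (Icc 0 1) s)‖ ^ 2 +
      2 * t * inner ℝ (generator E S (S (s * t) (γ s)))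
        (flowDifferential E S (s * t) (γ s) (velocityWithin E γ (Icc 0 1) s)) +
      t ^ 2 * ‖generator E S (S (s * t) (γ s))‖ ^ 2 := by
  have h : action E S γ t s = ‖(t • generator E S (S (s * t) (γ s)) +
      flowDifferential E S (s * t) (γ s) (velocityWithin E γ (Icc 0 1) s) :
        TangentSpace 𝓘(ℝ, E) (S (s * t) (γ s)))‖ ^ 2 :=
    congrArg (fun v : TangentSpace 𝓘(ℝ, E) (S (s * t) (γ s)) => ‖v‖ ^ 2)
      (hS.velocityWithin_deform (uniqueDiffOn_Icc zero_lt_one s hs) (fun _ h => h.1) hs ht hγ)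
  rw [h, norm_add_sq_real, norm_smul, real_inner_smul_left, mul_pow, Real.norm_eq_abs, sq_abs]
  ring

variable [IsManifold 𝓘(ℝ, E) ∞ X]
  [IsContMDiffRiemannianBundle 𝓘(ℝ, E) ∞ E (fun x : X => TangentSpace 𝓘(ℝ, E) x)]

lemma contDiffOn_action (hS : IsSmoothSemigroup E S) {s : ℝ} (hs : s ∈ Icc (0 : ℝ) 1)
    (hγ : MDifferentiableWithinAt 𝓘(ℝ, ℝ) 𝓘(ℝ, E) γ (Icc 0 1) s) :
    ContDiffOn ℝ ∞ (fun t => action E S γ t s) (Ici 0) := by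
  have hmul : ContDiffOn ℝ ∞ (fun t : ℝ => s * t) (Ici 0) := by fun_prop
  have hmaps : MapsTo (fun t => s * t) (Ici 0) (Ici (0 : ℝ)) := fun t ht => mul_nonneg hs.1 ht
  have hN := (hS.contDiffOn_norm_sq_flowDifferential
    (velocityWithin E γ (Icc 0 1) s)).comp hmul hmaps
  have hB := (hS.contDiffOn_inner_generator_flowDifferential
    (velocityWithin E γ (Icc 0 1) s)).comp hmul hmaps
  have hC := (hS.contDiffOn_norm_sq_generator (γ s)).comp hmul hmaps
  exact ((hN.add ((contDiffOn_const.mul contDiffOn_id).mul hB)).add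
    ((contDiffOn_id.pow 2).mul hC)).congr fun t ht => hS.action_eq hs ht hγ

lemma derivWithin_action_zero (hS : IsSmoothSemigroup E S) {s : ℝ} (hs : s ∈ Icc (0 : ℝ) 1)
    (hγ : MDifferentiableWithinAt 𝓘(ℝ, ℝ) 𝓘(ℝ, E) γ (Icc 0 1) s) :
    derivWithin (fun t => action E S γ t s) (Ici 0) 0 =
      s * derivWithin (fun t =>
        ‖flowDifferential E S t (γ s) (velocityWithin E γ (Icc 0 1) s)‖ ^ 2) (Ici 0) 0 +
      2 * inner ℝ (generator E S (γ s)) (velocityWithin E γ (Icc 0 1) s) := by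
  set w := velocityWithin E γ (Icc 0 1) s
  have hdiff {f : ℝ → ℝ} (hf : ContDiffOn ℝ ∞ f (Ici 0)) :=
    hasDerivWithinAt_Ici_comp_const_mul hs.1 (hf.differentiableOn (by simp) 0 self_mem_Ici)
  have hN := hdiff (hS.contDiffOn_norm_sq_flowDifferential w)
  have hB := hdiff (hS.contDiffOn_inner_generator_flowDifferential w)
  have hC := hdiff (hS.contDiffOn_norm_sq_generator (γ s))
  have hid := hasDerivWithinAt_id (0 : ℝ) (Ici 0)
  have hB0 : inner ℝ (generator E S (S (s * 0) (γ s))) (flowDifferential E S (s * 0) (γ s) w) =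
      inner ℝ (generator E S (γ s)) w :=
    (congrArg (fun r => inner ℝ (generator E S (S r (γ s))) (flowDifferential E S r (γ s) w))
      (mul_zero s)).trans <| inner_tangent_congr (hS.zero _)
        (congrArg (fun x => (generator E S x : E)) (hS.zero (γ s)))
        (hS.flowDifferential_zero (γ s) w)
  have hsum := (((hN.add ((hid.const_mul 2).mul hB)).add ((hid.pow 2).mul hC)).congr
    (fun t ht => hS.action_eq hs ht hγ) (hS.action_eq hs le_rfl hγ)).derivWithin
      (uniqueDiffOn_Ici 0 0 self_mem_Ici)
  simpa [hB0] using hsum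

end IsSmoothSemigroup

end Action

section ActionInequality

variable {E : Type*} [NormedAddCommGroup E] [NormedSpace ℝ E]
  {X : Type*} [TopologicalSpace X] [ChartedSpace E X] [IsManifold 𝓘(ℝ, E) ∞ X]
  [RiemannianBundle (fun x : X => TangentSpace 𝓘(ℝ, E) x)]
  [IsContMDiffRiemannianBundle 𝓘(ℝ, E) ∞ E (fun x : X => TangentSpace 𝓘(ℝ, E) x)]
  {S : ℝ → X → X} {F : X → ℝ} {lam : ℝ}

namespace ActionInequalityAt

lemma of_zero (hS : IsSmoothSemigroup E S) (h0 : ActionInequalityAt E F lam S 0) {t : ℝ}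
    (ht : 0 ≤ t) : ActionInequalityAt E F lam S t := by
  intro γ hγ s hs
  have hγs := hγ.mdifferentiableOn (by simp) s hs
  have hγt := hS.contMDiffOn_deform le_rfl hγ ht
  have hshift : derivWithin (fun h => action E S (deform S γ t) h s) (Ici 0) 0 =
      derivWithin (fun r => action E S γ r s) (Ici 0) t := by
    rw [← derivWithin_Ici_const_add ht
      ((hS.contDiffOn_action hs hγs).differentiableOn (by simp) t ht)]
    exact derivWithin_congr (fun h hh => hS.action_deform γ ht hh hs)
      (hS.action_deform γ ht le_rfl hs)
  simpa only [hshift, hS.deform_zero, hS.action_deform γ ht le_rfl hs, add_zero] using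
    h0 (deform S γ t) hγt s hs

lemma firstVariation_le (hS : IsSmoothSemigroup E S) (h0 : ActionInequalityAt E F lam S 0) {x : X}
    (hF : MDifferentiableAt 𝓘(ℝ, E) 𝓘(ℝ, ℝ) F x) (w : TangentSpace 𝓘(ℝ, E) x) {s : ℝ}
    (hs : s ∈ Icc (0 : ℝ) 1) :
    1 / 2 * (s * derivWithin (fun t => ‖flowDifferential E S t x w‖ ^ 2) (Ici 0) 0) +
      inner ℝ (generator E S x) w + mvfderiv 𝓘(ℝ, E) F x w ≤ -lam * s * ‖w‖ ^ 2 := by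
  obtain ⟨γ, hγ, rfl, hw⟩ := exists_curve_velocityWithin_eq x w hs
  obtain rfl : velocityWithin E γ (Icc 0 1) s = w := hw
  have hγs := hγ.mdifferentiableOn (by simp) s hs
  have hineq := h0 γ hγ s hs
  rw [hS.derivWithin_action_zero hs hγs, hS.action_zero, hS.deform_zero,
    derivWithin_comp_eq_mvfderiv hF hγs (uniqueDiffOn_Icc zero_lt_one s hs)] at hineq
  linarith

lemma inner_generator (hS : IsSmoothSemigroup E S) (h0 : ActionInequalityAt E F lam S 0) {x : X}
    (hF : MDifferentiableAt 𝓘(ℝ, E) 𝓘(ℝ, ℝ) F x) (w : TangentSpace 𝓘(ℝ, E) x) :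
    inner ℝ (generator E S x) w = -mvfderiv 𝓘(ℝ, E) F x w := by
  have hle (v : TangentSpace 𝓘(ℝ, E) x) :
      inner ℝ (generator E S x) v + mvfderiv 𝓘(ℝ, E) F x v ≤ 0 := by
    simpa using h0.firstVariation_le hS hF v (left_mem_Icc.2 zero_le_one)
  have hneg := hle (-w)
  rw [inner_neg_right, map_neg] at hneg
  linarith [hle w]

lemma derivWithin_norm_sq_flowDifferential_zero_le (hS : IsSmoothSemigroup E S)
    (h0 : ActionInequalityAt E F lam S 0) {x : X}
    (hF : MDifferentiableAt 𝓘(ℝ, E) 𝓘(ℝ, ℝ) F x) (w : TangentSpace 𝓘(ℝ, E) x) :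
    derivWithin (fun t => ‖flowDifferential E S t x w‖ ^ 2) (Ici 0) 0 ≤ -(2 * lam) * ‖w‖ ^ 2 := by
  linarith [h0.firstVariation_le hS hF w (right_mem_Icc.2 zero_le_one),
    h0.inner_generator hS hF w]

lemma norm_sq_flowDifferential_le (hS : IsSmoothSemigroup E S)
    (h0 : ActionInequalityAt E F lam S 0) (hF : MDifferentiable 𝓘(ℝ, E) 𝓘(ℝ, ℝ) F) {t : ℝ}
    (ht : 0 ≤ t) {x : X} (w : TangentSpace 𝓘(ℝ, E) x) :
    ‖flowDifferential E S t x w‖ ^ 2 ≤ Real.exp (-(2 * lam) * t) * ‖w‖ ^ 2 := by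
  have hdiff := (hS.contDiffOn_norm_sq_flowDifferential w).differentiableOn (by simp)
  have hadd {r h : ℝ} (hr : 0 ≤ r) (hh : 0 ≤ h) :
      ‖flowDifferential E S (r + h) x w‖ =
        ‖flowDifferential E S h (S r x) (flowDifferential E S r x w)‖ :=
    norm_tangent_congr (hS.add r h hr hh x) (hS.flowDifferential_add hr hh x w)
  have hbound (r : ℝ) (hr : 0 ≤ r) :
      derivWithin (fun t => ‖flowDifferential E S t x w‖ ^ 2) (Ici 0) r ≤
        -(2 * lam) * ‖flowDifferential E S r x w‖ ^ 2 := by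
    have hshift : derivWithin (fun h => ‖flowDifferential E S (r + h) x w‖ ^ 2) (Ici 0) 0 =
        derivWithin (fun h => ‖flowDifferential E S h (S r x) (flowDifferential E S r x w)‖ ^ 2)
          (Ici 0) 0 :=
      derivWithin_congr (fun h hh => congrArg (· ^ 2) (hadd hr hh))
        (congrArg (· ^ 2) (hadd hr le_rfl))
    rw [← derivWithin_Ici_const_add hr (hdiff r hr), hshift]
    exact h0.derivWithin_norm_sq_flowDifferential_zero_le hS (hF _) _
  have hgronwall := le_exp_mul_of_derivWithin_le hdiff hbound ht
  rwa [norm_tangent_congr (hS.zero x) (hS.flowDifferential_zero x w)] at hgronwall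

lemma norm_sq_velocityWithin_deform_le (hS : IsSmoothSemigroup E S)
    (h0 : ActionInequalityAt E F lam S 0) (hF : MDifferentiable 𝓘(ℝ, E) 𝓘(ℝ, ℝ) F) {γ : ℝ → X}
    {s t : ℝ} (hs : s ∈ Icc (0 : ℝ) 1) (ht : 0 ≤ t)
    (hγ : MDifferentiableWithinAt 𝓘(ℝ, ℝ) 𝓘(ℝ, E) γ (Icc 0 1) s)
    (hγt : MDifferentiableWithinAt 𝓘(ℝ, ℝ) 𝓘(ℝ, E) (deform S γ t) (Icc 0 1) s) :
    ‖velocityWithin E (deform S γ t) (Icc 0 1) s‖ ^ 2 ≤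
      Real.exp (-(2 * (lam * t) * s)) * ‖velocityWithin E γ (Icc 0 1) s‖ ^ 2 -
        2 * t * derivWithin (fun σ => F (deform S γ t σ)) (Icc 0 1) s := by
  have hunique := uniqueDiffOn_Icc (zero_lt_one (α := ℝ)) s hs
  have hdiff := h0.norm_sq_flowDifferential_le hS hF (mul_nonneg hs.1 ht)
    (velocityWithin E γ (Icc 0 1) s)
  set β : TangentSpace 𝓘(ℝ, E) (S (s * t) (γ s)) := velocityWithin E (deform S γ t) (Icc 0 1) s
  set V : TangentSpace 𝓘(ℝ, E) (S (s * t) (γ s)) := generator E S (S (s * t) (γ s))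
  set D := flowDifferential E S (s * t) (γ s) (velocityWithin E γ (Icc 0 1) s)
  have hgrad : inner ℝ V β = -derivWithin (fun σ => F (deform S γ t σ)) (Icc 0 1) s := by
    rw [derivWithin_comp_eq_mvfderiv (hF _) hγt hunique]
    exact h0.inner_generator hS (hF _) _
  have hβ : D = β - t • V := by
    rw [eq_sub_iff_add_eq, add_comm]
    exact (hS.velocityWithin_deform hunique (fun _ h => h.1) hs ht hγ).symm
  have hexpand : ‖D‖ ^ 2 = ‖β‖ ^ 2 - 2 * t * inner ℝ V β + ‖t • V‖ ^ 2 := by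
    rw [hβ, norm_sub_sq_real, real_inner_smul_right, real_inner_comm]
    ring
  have hβ_le : ‖β‖ ^ 2 ≤ Real.exp (-(2 * lam) * (s * t)) * ‖velocityWithin E γ (Icc 0 1) s‖ ^ 2 -
      2 * t * derivWithin (fun σ => F (deform S γ t σ)) (Icc 0 1) s := by
    rw [hgrad] at hexpand
    linarith [sq_nonneg ‖t • V‖]
  rw [show -(2 * (lam * t) * s) = -(2 * lam) * (s * t) by ring]
  exact hβ_le

end ActionInequalityAt

end ActionInequality

section GradientFlow

variable {E : Type*} [NormedAddCommGroup E] [NormedSpace ℝ E] [FiniteDimensional ℝ E]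
  {X : Type*} [TopologicalSpace X] [ChartedSpace E X]
  [RiemannianBundle (fun x : X => TangentSpace 𝓘(ℝ, E) x)]

lemma inner_grad (F : X → ℝ) (x : X) (w : TangentSpace 𝓘(ℝ, E) x) :
    inner ℝ (grad E F x) w = mvfderiv 𝓘(ℝ, E) F x w := by
  have : FiniteDimensional ℝ (TangentSpace 𝓘(ℝ, E) x) := inferInstanceAs (FiniteDimensional ℝ E)
  have : CompleteSpace (TangentSpace 𝓘(ℝ, E) x) := FiniteDimensional.complete ℝ _
  exact InnerProductSpace.toDual_symm_apply

lemma ActionInequalityAt.isGradientFlow [IsManifold 𝓘(ℝ, E) ∞ X]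
    [IsContMDiffRiemannianBundle 𝓘(ℝ, E) ∞ E (fun x : X => TangentSpace 𝓘(ℝ, E) x)]
    {S : ℝ → X → X} {F : X → ℝ} {lam : ℝ} (hS : IsSmoothSemigroup E S)
    (h0 : ActionInequalityAt E F lam S 0) (hF : MDifferentiable 𝓘(ℝ, E) 𝓘(ℝ, ℝ) F) :
    IsGradientFlow E F S := by
  have hgrad : generator E S = fun x => -grad E F x := funext fun x => ext_inner_right ℝ fun w => by
    rw [h0.inner_generator hS (hF x), inner_neg_left, inner_grad]
  exact fun u => ⟨hS.zero u, hgrad ▸ hS.isMIntegralCurveOn_generator u⟩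

end GradientFlow

section OneStep

lemma isContinuousRiemannianBundle_of_contMDiff (E : Type*) [NormedAddCommGroup E]
    [NormedSpace ℝ E] (X : Type*) [TopologicalSpace X] [ChartedSpace E X]
    [IsManifold 𝓘(ℝ, E) ∞ X] [RiemannianBundle (fun x : X => TangentSpace 𝓘(ℝ, E) x)]
    [IsContMDiffRiemannianBundle 𝓘(ℝ, E) ∞ E (fun x : X => TangentSpace 𝓘(ℝ, E) x)] :
    IsContinuousRiemannianBundle E (fun x : X => TangentSpace 𝓘(ℝ, E) x) := by
  obtain ⟨g, hg, hgi⟩ := IsContMDiffRiemannianBundle.exists_contMDiff (IB := 𝓘(ℝ, E)) (n := ∞)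
    (F := E) (E := fun x : X => TangentSpace 𝓘(ℝ, E) x)
  exact ⟨g, hg.continuous, hgi⟩

variable {E : Type*} [NormedAddCommGroup E] [NormedSpace ℝ E]
  {X : Type*} [MetricSpace X] [ChartedSpace E X] [IsManifold 𝓘(ℝ, E) ∞ X]
  [RiemannianBundle (fun x : X => TangentSpace 𝓘(ℝ, E) x)]
  [IsContMDiffRiemannianBundle 𝓘(ℝ, E) ∞ E (fun x : X => TangentSpace 𝓘(ℝ, E) x)]
  [IsRiemannianManifold 𝓘(ℝ, E) X] {S : ℝ → X → X} {F : X → ℝ} {lam : ℝ}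

lemma ActionInequalityAt.dist_sq_deform_le
    (hS : IsSmoothSemigroup E S) (h0 : ActionInequalityAt E F lam S 0)
    (hF : ContMDiff 𝓘(ℝ, E) 𝓘(ℝ, ℝ) 1 F) {γ : ℝ → X}
    (hγ : ContMDiffOn 𝓘(ℝ, ℝ) 𝓘(ℝ, E) 1 γ (Icc 0 1)) {k : ℝ}
    (hγk : ∀ s ∈ Icc (0 : ℝ) 1, ‖velocityWithin E γ (Icc 0 1) s‖ ≤ k) {t : ℝ} (ht : 0 ≤ t) :
    dist (deform S γ t 0) (deform S γ t 1) ^ 2 ≤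
      expMean (lam * t) * k ^ 2 + 2 * t * (F (deform S γ t 0) - F (deform S γ t 1)) := by
  have := isContinuousRiemannianBundle_of_contMDiff E X
  have hβ := hS.contMDiffOn_deform (by simp) hγ ht
  have hFβ : ContDiffOn ℝ 1 (fun σ => F (deform S γ t σ)) (Icc 0 1) :=
    (hF.comp_contMDiffOn hβ).contDiffOn
  have hderiv := hFβ.continuousOn_derivWithin (uniqueDiffOn_Icc zero_lt_one) le_rfl
  have hexp : Continuous fun s => Real.exp (-(2 * (lam * t) * s)) * k ^ 2 := by fun_prop
  have hspeed (s : ℝ) (hs : s ∈ Icc (0 : ℝ) 1) :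
      ‖velocityWithin E (deform S γ t) (Icc 0 1) s‖ ^ 2 ≤
        Real.exp (-(2 * (lam * t) * s)) * k ^ 2 -
          2 * t * derivWithin (fun σ => F (deform S γ t σ)) (Icc 0 1) s :=
    (h0.norm_sq_velocityWithin_deform_le hS (hF.mdifferentiable one_ne_zero) hs ht
      (hγ.mdifferentiableOn one_ne_zero s hs) (hβ.mdifferentiableOn one_ne_zero s hs)).trans
        (by gcongr; exact hγk s hs)
  have hdist := dist_sq_le_integral hβ
    (g := fun s => Real.exp (-(2 * (lam * t) * s)) * k ^ 2 -
      2 * t * derivWithin (fun σ => F (deform S γ t σ)) (Icc 0 1) s)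
    (hexp.continuousOn.sub (hderiv.const_mul (2 * t))) hspeed
  rw [intervalIntegral.integral_sub (hexp.intervalIntegrable _ _)
      ((hderiv.const_mul _).intervalIntegrable_of_Icc zero_le_one),
    intervalIntegral.integral_mul_const, intervalIntegral.integral_const_mul,
    intervalIntegral.integral_derivWithin_Icc_of_contDiffOn_Icc hFβ zero_le_one, ← expMean]
    at hdist
  linarith

lemma ActionInequalityAt.satisfiesOneStepEVI
    (hS : IsSmoothSemigroup E S) (h0 : ActionInequalityAt E F lam S 0)
    (hF : ContMDiff 𝓘(ℝ, E) 𝓘(ℝ, ℝ) 1 F) : SatisfiesOneStepEVI F lam S := by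
  have := isContinuousRiemannianBundle_of_contMDiff E X
  intro u v h hh
  have hspeed (k : ℝ) (hk : dist u v < k) :
      dist (S h u) v ^ 2 ≤ expMean (lam * h) * k ^ 2 + 2 * h * (F v - F (S h u)) := by
    obtain ⟨γ, hγ, rfl, rfl, hγk⟩ := exists_curve_norm_velocityWithin_le E (dist_comm u v ▸ hk)
    simpa only [deform, zero_mul, one_mul, hS.zero, dist_comm] using
      h0.dist_sq_deform_le hS hF hγ hγk hh
  have hlim : Tendsto (fun k => expMean (lam * h) * k ^ 2 + 2 * h * (F v - F (S h u)))
      (𝓝[>] dist u v) (𝓝 (expMean (lam * h) * dist u v ^ 2 + 2 * h * (F v - F (S h u)))) :=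
    ((by fun_prop : Continuous fun k => expMean (lam * h) * k ^ 2 +
      2 * h * (F v - F (S h u))).tendsto _).mono_left nhdsWithin_le_nhds
  exact ge_of_tendsto hlim (eventually_nhdsWithin_of_forall hspeed)

end OneStep

end ActionFlow

end

theorem theorem2p2_general
    {E : Type*} [NormedAddCommGroup E] [NormedSpace ℝ E] [FiniteDimensional ℝ E]
    {X : Type*} [MetricSpace X] [ChartedSpace E X] [IsManifold 𝓘(ℝ, E) ∞ X]
    [RiemannianBundle (fun x : X => TangentSpace 𝓘(ℝ, E) x)]
    [IsContMDiffRiemannianBundle 𝓘(ℝ, E) ∞ E (fun x : X => TangentSpace 𝓘(ℝ, E) x)]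
    [IsRiemannianManifold 𝓘(ℝ, E) X]
    (F : X → ℝ) (hF : ContMDiff 𝓘(ℝ, E) 𝓘(ℝ, ℝ) 1 F) (lam : ℝ)
    (S : ℝ → X → X) (hS : ActionFlow.IsSmoothSemigroup E S)
    (h0 : ActionFlow.ActionInequalityAt E F lam S 0) :
    (ActionFlow.SatisfiesEVI F lam S ∧ ActionFlow.IsGradientFlow E F S ∧
      ActionFlow.GeodesicallyConvex F lam) ∧
      ∀ t : ℝ, 0 ≤ t → ActionFlow.ActionInequalityAt E F lam S t := by
  have hstep := h0.satisfiesOneStepEVI hS hF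
  have hcont := hS.tendsto_comp_trajectory hF.continuous
  exact ⟨⟨hstep.satisfiesEVI hS.add hcont, h0.isGradientFlow hS (hF.mdifferentiable one_ne_zero),
    hstep.geodesicallyConvex hcont⟩, fun _ ht => h0.of_zero hS ht⟩

theorem theorem2p2
    {E : Type*} [NormedAddCommGroup E] [NormedSpace ℝ E] [FiniteDimensional ℝ E]
    {X : Type*} [MetricSpace X] [CompleteSpace X] [ChartedSpace E X] [IsManifold 𝓘(ℝ, E) ∞ X]
    [RiemannianBundle (fun x : X => TangentSpace 𝓘(ℝ, E) x)]
    [IsContMDiffRiemannianBundle 𝓘(ℝ, E) ∞ E (fun x : X => TangentSpace 𝓘(ℝ, E) x)]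
    [IsRiemannianManifold 𝓘(ℝ, E) X]
    (F : X → ℝ) (hF : ContMDiff 𝓘(ℝ, E) 𝓘(ℝ, ℝ) ∞ F) (lam : ℝ)
    (S : ℝ → X → X) (hS : ActionFlow.IsSmoothSemigroup E S) :
    ((∀ t : ℝ, 0 ≤ t → ActionFlow.ActionInequalityAt E F lam S t) →
      ActionFlow.SatisfiesEVI F lam S ∧ ActionFlow.IsGradientFlow E F S ∧
        ActionFlow.GeodesicallyConvex F lam) ∧
    (ActionFlow.ActionInequalityAt E F lam S 0 →
      ∀ t : ℝ, 0 ≤ t → ActionFlow.ActionInequalityAt E F lam S t) := by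
  have hgen := theorem2p2_general F (hF.of_le (by simp)) lam S hS
  exact ⟨fun h => (hgen (h 0 le_rfl)).1, fun h0 => (hgen h0).2⟩
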